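/- Let $\Gamma\subset SU(2)$ be a finite subgroup, $c_\Gamma$ its exponent (the least common multiple of the orders of its elements), and $\alpha$ an irreducible complex representation of $\Gamma$ of dimension $N$ with character $\chi_\alpha$. Let $E_k$ be the $(k+1)$-dimensional representation of $SU(2)$ on homogeneous complex polynomials of degree $k$ in two variables, $(g\cdot p)(z)=p(zg)$, let $\langle \chi,\psi\rangle_\Gamma=\frac1{\#\Gamma}\sum_{g\in\Gamma}\chi(g)\overline{\psi(g)}$, and put $$\beta_m^\alpha=\langle\chi_{E_{m-1}},\chi_\alpha\rangle_\Gamma\quad(1\le m\le c_\Gamma),\qquad \gamma_m^\alpha=\langle\chi_{E_{m+1}},\chi_\alpha\rangle_\Gamma\quad(0\le m\le c_\Gamma-1).$$ For $1\le m\le c_\Gamma$ let $m'$ be the unique integer with $0\le m'\le c_\Gamma-1$ and $c_\Gamma\mid m+m'+2$. (a) Suppose $-1\in\Gamma$. Write $X_m=\chi_\alpha(1)+(-1)^{m+1}\chi_\alpha(-1)$ and $$P_m^+(u)=\tfrac{X_m}{\#\Gamma}u^2+\Big(\beta_m^\alpha-\tfrac{mX_m}{\#\Gamma}\Big)u+\tfrac12\beta_m^\alpha-\tfrac{X_m}{4\#\Gamma}-\tfrac{mX_m}{2\#\Gamma},$$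 $$P_m^-(u)=\tfrac{X_m}{\#\Gamma}u^2+\Big(\tfrac{(2+m)X_m}{\#\Gamma}-\gamma_m^\alpha\Big)u+\tfrac{(3+2m)X_m}{4\#\Gamma}-\tfrac12\gamma_m^\alpha .$$ Then for every $1\le m\le c_\Gamma$ the polynomial identity $P_m^+=P_{m'}^-$ is equivalent to $$\beta_m^\alpha+\gamma_{m'}^\alpha=\begin{cases}\frac{c_\Gamma}{\#\Gamma}\big(\chi_\alpha(1)+(-1)^{m+1}\chi_\alpha(-1)\big)&\text{if }1\le m\le c_\Gamma-2,\\ \frac{2c_\Gamma}{\#\Gamma}\big(\chi_\alpha(1)+\chi_\alpha(-1)\big)&\text{if }m=c_\Gamma-1,\\ \frac{2c_\Gamma}{\#\Gamma}\big(\chi_\alpha(1)-\chi_\alpha(-1)\big)&\text{if }m=c_\Gamma,\end{cases}$$ and this identity holds for every such $m$. (b) Suppose $-1\notin\Gamma$, and write $n=\#\Gamma$ and $$P_m^+(u)=\tfrac Nn u^2+\Big(\beta_m^\alpha-\tfrac{mN}n\Big)u+\tfrac{\beta_m^\alpha}2-\tfrac{mN}{2n}-\tfrac N{4n},$$ $$P_m^-(u)=\tfrac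 Nn u^2+\Big(\tfrac{2N}n+\tfrac{mN}n-\gamma_m^\alpha\Big)u+\tfrac{3N}{4n}+\tfrac{mN}{2n}-\tfrac{\gamma_m^\alpha}2 .$$ Then for every $1\le m\le c_\Gamma$ the polynomial identity $P_m^+=P_{m'}^-$ is equivalent to $$\beta_m^\alpha+\gamma_{m'}^\alpha=\begin{cases}\chi_\alpha(1)&\text{if }c_\Gamma\ge2,\ 1\le m\le c_\Gamma-2,\\ 2\chi_\alpha(1)&\text{if }c_\Gamma\ge2,\ m\in\{c_\Gamma-1,c_\Gamma\},\\ 3\chi_\alpha(1)&\text{if }c_\Gamma=1\text{ (so }\Gamma\text{ is trivial, }m=1,\ m'=0),\end{cases}$$ and this identity holds for every such $m$. -/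

import Mathlib

noncomputable section

namespace TwistedSpectrum

open Polynomial

/-- The group `SU(2)`. -/
abbrev SU2 : Type := Matrix.specialUnitaryGroup (Fin 2) ℂ

/-- The element `-1` of `SU(2)`. -/
def negOne : SU2 :=
  ⟨-1, by
    rw [Matrix.mem_specialUnitaryGroup_iff, Matrix.mem_unitaryGroup_iff]
    constructor
    · simp
    · simp [Matrix.det_fin_two]⟩

/-- The substitution `p(z) ↦ p(z g)` on complex polynomials in `z = (z₀, z₁)`, where `z g` is the
product of a row vector with a matrix. -/
def substHom (g : Matrix (Fin 2) (Fin 2) ℂ) :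
    MvPolynomial (Fin 2) ℂ →ₐ[ℂ] MvPolynomial (Fin 2) ℂ :=
  MvPolynomial.aeval fun j => ∑ i, MvPolynomial.C (g i j) * MvPolynomial.X i

theorem substHom_one : substHom 1 = AlgHom.id ℂ _ := by
  apply MvPolynomial.algHom_ext
  intro j
  fin_cases j <;> simp [substHom, Fin.sum_univ_two]

theorem substHom_mul (g h : Matrix (Fin 2) (Fin 2) ℂ) :
    substHom (g * h) = (substHom g).comp (substHom h) := by
  apply MvPolynomial.algHom_ext
  intro j
  simp only [substHom, MvPolynomial.aeval_X, AlgHom.comp_apply, map_mul,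
    MvPolynomial.algHom_C, MvPolynomial.algebraMap_eq, Fin.sum_univ_two, Matrix.mul_apply, map_add]
  ring

theorem substHom_mem (g : Matrix (Fin 2) (Fin 2) ℂ) (k : ℕ) (p : MvPolynomial (Fin 2) ℂ)
    (hp : p ∈ MvPolynomial.homogeneousSubmodule (Fin 2) ℂ k) :
    (substHom g).toLinearMap p ∈ MvPolynomial.homogeneousSubmodule (Fin 2) ℂ k := by
  rw [MvPolynomial.mem_homogeneousSubmodule] at hp ⊢
  have h := hp.aeval (n := 1) (fun j => ∑ i, MvPolynomial.C (g i j) * MvPolynomial.X i) (by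
    intro j
    apply MvPolynomial.IsHomogeneous.sum
    intro i _
    exact MvPolynomial.isHomogeneous_C_mul_X _ _)
  simpa [substHom] using h

/-- The representation `E_k` of `SU(2)` on the `(k+1)`-dimensional space of homogeneous complex
polynomials of degree `k` in two variables, `(g • p)(z) = p(z g)`. -/
def E (k : ℕ) : Representation ℂ SU2 (MvPolynomial.homogeneousSubmodule (Fin 2) ℂ k) where
  toFun g := (substHom g.1).toLinearMap.restrict (substHom_mem g.1 k)
  map_one' := by
    ext p : 2
    simp [substHom_one]
  map_mul' g h := by
    ext p : 2
    simp [substHom_mul]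

variable {V : Type*} [AddCommGroup V] [Module ℂ V]

/-- The pairing `⟨χ_{E_k}, χ_α⟩_Γ = (1 / #Γ) ∑_{g ∈ Γ} χ_{E_k}(g) * conj (χ_α(g))`. -/
def pairing (Γ : Subgroup SU2) [Finite Γ] (α : Representation ℂ Γ V) (k : ℕ) : ℂ :=
  (Nat.card Γ : ℂ)⁻¹ * ∑ᶠ g : Γ, (E k).character (g : SU2) * star (α.character g)

/-- `β_m^α = ⟨χ_{E_{m-1}}, χ_α⟩_Γ`; it is used only for `m ≥ 1`. -/
def beta (Γ : Subgroup SU2) [Finite Γ] (α : Representation ℂ Γ V) (m : ℕ) : ℂ :=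
  pairing Γ α (m - 1)

/-- `γ_m^α = ⟨χ_{E_{m+1}}, χ_α⟩_Γ`, for `m ≥ 0`. -/
def gamma (Γ : Subgroup SU2) [Finite Γ] (α : Representation ℂ Γ V) (m : ℕ) : ℂ :=
  pairing Γ α (m + 1)

/-- `χ_α(1) + (-1)^{m+1} χ_α(-1)`, for a group `Γ` that contains `-1`. -/
def chiSum (Γ : Subgroup SU2) (h : negOne ∈ Γ) (α : Representation ℂ Γ V) (m : ℕ) : ℂ :=
  α.character 1 + (-1) ^ (m + 1) * α.character ⟨negOne, h⟩

/-- The polynomial `P_m^+` when `-1 ∈ Γ`. -/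
def evenPlus (Γ : Subgroup SU2) [Finite Γ] (h : negOne ∈ Γ) (α : Representation ℂ Γ V) (m : ℕ) :
    ℂ[X] :=
  C (1 / (Nat.card Γ : ℂ) * chiSum Γ h α m) * X ^ 2
    + C (beta Γ α m - 1 / (Nat.card Γ : ℂ) * (m * chiSum Γ h α m)) * X
    + C (1 / 2 * beta Γ α m - 1 / (4 * (Nat.card Γ : ℂ)) * chiSum Γ h α m
        - 1 / (2 * (Nat.card Γ : ℂ)) * (m * chiSum Γ h α m))

/-- The polynomial `P_m^-` when `-1 ∈ Γ`. -/
def evenMinus (Γ : Subgroup SU2) [Finite Γ] (h : negOne ∈ Γ) (α : Representation ℂ Γ V) (m : ℕ) :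
    ℂ[X] :=
  C (1 / (Nat.card Γ : ℂ) * chiSum Γ h α m) * X ^ 2
    + C ((2 + m) / (Nat.card Γ : ℂ) * chiSum Γ h α m - gamma Γ α m) * X
    + C ((3 + 2 * m) / (4 * (Nat.card Γ : ℂ)) * chiSum Γ h α m - 1 / 2 * gamma Γ α m)

/-- The polynomial `P_m^+` when `-1 ∉ Γ`, with `N = dim α` and `n = #Γ`. -/
def oddPlus (Γ : Subgroup SU2) [Finite Γ] (α : Representation ℂ Γ V) (m : ℕ) : ℂ[X] :=
  let N : ℂ := Module.finrank ℂ V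
  let n : ℂ := Nat.card Γ
  C (N / n) * X ^ 2 + C (beta Γ α m - m * N / n) * X
    + C (beta Γ α m / 2 - m * N / (2 * n) - N / (4 * n))

/-- The polynomial `P_m^-` when `-1 ∉ Γ`, with `N = dim α` and `n = #Γ`. -/
def oddMinus (Γ : Subgroup SU2) [Finite Γ] (α : Representation ℂ Γ V) (m : ℕ) : ℂ[X] :=
  let N : ℂ := Module.finrank ℂ V
  let n : ℂ := Nat.card Γ
  C (N / n) * X ^ 2 + C (2 * N / n + m * N / n - gamma Γ α m) * X
    + C (3 * N / (4 * n) + m * N / (2 * n) - gamma Γ α m / 2)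

/-- `m ∈ {1, …, c}` and `m'` is the number in `{0, …, c - 1}` with `c ∣ m + m' + 2`. -/
def IsMatchedIndex (c m m' : ℕ) : Prop :=
  1 ≤ m ∧ m ≤ c ∧ m' < c ∧ c ∣ m + m' + 2

/-- The value of `β_m^α + γ_{m'}^α` when `-1 ∈ Γ`. -/
def evenValue (Γ : Subgroup SU2) (h : negOne ∈ Γ) (α : Representation ℂ Γ V) (m : ℕ) : ℂ :=
  let c := Monoid.exponent Γ
  let q : ℂ := (c : ℂ) / (Nat.card Γ : ℂ)
  if m + 2 ≤ c then q * (α.character 1 + (-1) ^ (m + 1) * α.character ⟨negOne, h⟩)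
  else if m + 1 = c then 2 * q * (α.character 1 + α.character ⟨negOne, h⟩)
  else 2 * q * (α.character 1 - α.character ⟨negOne, h⟩)

/-- The value of `β_m^α + γ_{m'}^α` when `-1 ∉ Γ`. -/
def oddValue (Γ : Subgroup SU2) (α : Representation ℂ Γ V) (m : ℕ) : ℂ :=
  let c := Monoid.exponent Γ
  if c = 1 then 3 * α.character 1
  else if m + 2 ≤ c then α.character 1
  else 2 * α.character 1

end TwistedSpectrum

end

/-! Comparing coefficients, `P_m^+ = P_{m'}^-` carries a single condition. The `u²` coefficients
agree and the constant terms differ by half of what the `u` coefficients differ by, so all that is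
asked is `β_m + γ_{m'} = (m + m' + 2) X / #Γ`, with `X = χ_α(1)` in the odd case.

This holds by cancellation (`character_E_add_eq_zero`). If `g ≠ ±1` has eigenvalues `x`, `y = x⁻¹`,
then `χ_{E_k}(g) = (x^(k+1) - y^(k+1)) / (x - y)`. With `a = m - 1` and `b = m' + 1`, the exponent
divides `a + b + 2`, so `x^(a+1) = y^(b+1)` and the values for `a` and `b` are opposite. Only `g =
±1` contributes to the pairings.

The case values follow from `m + m' + 2 ∈ {c, 2c, 3c}`. The odd case also needs `c = #Γ`, that is,
`Γ` cyclic (`isCyclic_of_negOne_notMem`). Here `#Γ` is odd, so squaring permutes `Γ`; if `ℂ²` were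
irreducible, `∑ tr(g²) = ∑ (tr g)² - 2#Γ = -#Γ` would contradict `∑ tr g = 0`. -/

noncomputable section

namespace TwistedSpectrum

/-! ### Traces of substitutions on homogeneous polynomials. -/

open MvPolynomial in
/-- The coordinates of a homogeneous polynomial of degree `k` in two variables. -/
def homogeneousCoordEquiv (k : ℕ) :
    homogeneousSubmodule (Fin 2) ℂ k ≃ₗ[ℂ] (Fin (k + 1) → ℂ) :=
  LinearEquiv.ofBijective
    (LinearMap.pi fun i : Fin (k + 1) =>
      (MvPolynomial.lcoeff ℂ (Finsupp.single (0 : Fin 2) (i : ℕ) + Finsupp.single 1 (k - i))).comp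
        (homogeneousSubmodule (Fin 2) ℂ k).subtype) (by
    constructor
    · rw [injective_iff_map_eq_zero]
      rintro ⟨p, hp⟩ h
      ext d
      rw [mem_homogeneousSubmodule] at hp
      by_contra hd
      have hdeg : d.degree = k := by
        rw [Finsupp.degree_eq_weight_one]
        exact hp hd
      rw [Finsupp.degree_eq_sum, Fin.sum_univ_two] at hdeg
      apply hd
      have := congrFun h ⟨d 0, by omega⟩
      have hd' : d = Finsupp.single (0 : Fin 2) (d 0) + Finsupp.single 1 (k - d 0) := by
        ext j
        fin_cases j
        · simp
        · simp; omega
      rw [hd']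
      simpa using this
    · intro f
      refine ⟨⟨∑ i : Fin (k + 1),
        monomial (Finsupp.single (0 : Fin 2) (i : ℕ) + Finsupp.single 1 (k - i)) (f i), ?_⟩, ?_⟩
      · refine Submodule.sum_mem _ fun i _ => ?_
        rw [mem_homogeneousSubmodule]
        apply isHomogeneous_monomial
        have := i.2
        simp [Finsupp.degree_eq_sum, Fin.sum_univ_two]
        omega
      · ext i
        simp only [LinearMap.pi_apply, LinearMap.comp_apply, Submodule.subtype_apply,
          lcoeff_apply, coeff_sum, coeff_monomial]
        rw [Finset.sum_eq_single i]
        · simp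
        · intro j _ hj
          rw [if_neg]
          intro h
          apply hj
          have := DFunLike.congr_fun h 0
          simp at this
          exact Fin.ext this
        · simp)

open MvPolynomial in
theorem homogeneousCoordEquiv_apply (k : ℕ) (p : homogeneousSubmodule (Fin 2) ℂ k)
    (i : Fin (k + 1)) :
    homogeneousCoordEquiv k p i =
      coeff (Finsupp.single (0 : Fin 2) (i : ℕ) + Finsupp.single 1 (k - i)) p.1 := rfl

/-- The action of a matrix on homogeneous polynomials of degree `k` by substitution. -/
def substRestrict (k : ℕ) (g : Matrix (Fin 2) (Fin 2) ℂ) :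
    Module.End ℂ (MvPolynomial.homogeneousSubmodule (Fin 2) ℂ k) :=
  (substHom g).toLinearMap.restrict (substHom_mem g k)

theorem substRestrict_mul (k : ℕ) (g h : Matrix (Fin 2) (Fin 2) ℂ) :
    substRestrict k (g * h) = substRestrict k g * substRestrict k h := by
  ext p : 2
  simp [substRestrict, substHom_mul]

theorem coeff_substHom_diagonal (x y : ℂ) (p : MvPolynomial (Fin 2) ℂ) (d : Fin 2 →₀ ℕ) :
    (substHom (Matrix.diagonal ![x, y]) p).coeff d = x ^ d 0 * y ^ d 1 * p.coeff d := by
  induction p using MvPolynomial.induction_on' with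
  | monomial e a =>
    have : substHom (Matrix.diagonal ![x, y]) (MvPolynomial.monomial e a)
        = MvPolynomial.monomial e (x ^ e 0 * y ^ e 1 * a) := by
      rw [MvPolynomial.monomial_eq, MvPolynomial.monomial_eq]
      simp [substHom, Finsupp.prod_fintype, Fin.prod_univ_two, Fin.sum_univ_two, mul_pow]
      ring
    rw [this]
    simp only [MvPolynomial.coeff_monomial]
    split_ifs with h
    · rw [h]
    · simp
  | add p q hp hq => simp only [map_add, MvPolynomial.coeff_add, hp, hq]; ring

theorem trace_substRestrict_diagonal (k : ℕ) (x y : ℂ) :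
    LinearMap.trace ℂ _ (substRestrict k (Matrix.diagonal ![x, y])) =
      ∑ i ∈ Finset.range (k + 1), x ^ i * y ^ (k - i) := by
  rw [LinearMap.trace_eq_matrix_trace ℂ (Module.Basis.ofEquivFun (homogeneousCoordEquiv k)),
    Matrix.trace, Finset.sum_range]
  refine Finset.sum_congr rfl fun i _ => ?_
  rw [Matrix.diag_apply, LinearMap.toMatrix_apply, Module.Basis.ofEquivFun_repr_apply,
    homogeneousCoordEquiv_apply]
  have h1 : (substRestrict k (Matrix.diagonal ![x, y])
      (Module.Basis.ofEquivFun (homogeneousCoordEquiv k) i)).1 =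
      substHom (Matrix.diagonal ![x, y]) (Module.Basis.ofEquivFun (homogeneousCoordEquiv k) i).1 :=
    rfl
  rw [h1, coeff_substHom_diagonal, ← homogeneousCoordEquiv_apply]
  simp

theorem character_E_eq (k : ℕ) (g : SU2) :
    (E k).character g = LinearMap.trace ℂ _ (substRestrict k g.1) := rfl

/-- Substitution is defined for all matrices, so the diagonalizing `P` need not be unitary. -/
theorem trace_substRestrict_of_conj (k : ℕ) {g P : Matrix (Fin 2) (Fin 2) ℂ} {x y : ℂ}
    (hP : IsUnit P.det) (h : g * P = P * Matrix.diagonal ![x, y]) :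
    LinearMap.trace ℂ _ (substRestrict k g) =
      ∑ i ∈ Finset.range (k + 1), x ^ i * y ^ (k - i) := by
  have hg : g = P * (Matrix.diagonal ![x, y] * P⁻¹) := by
    rw [← mul_assoc, ← h, mul_assoc, Matrix.mul_nonsing_inv _ hP, mul_one]
  rw [hg, substRestrict_mul, LinearMap.trace_mul_comm, ← substRestrict_mul, mul_assoc,
    Matrix.nonsing_inv_mul _ hP, mul_one, trace_substRestrict_diagonal]

/-! ### Eigenvectors and traces in `SU(2)`. -/

theorem exists_mulVec_eq_smul {g : Matrix (Fin 2) (Fin 2) ℂ} (hdet : g.det = 1) {x : ℂ}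
    (hx : x ^ 2 - g.trace * x + 1 = 0) : ∃ v : Fin 2 → ℂ, v ≠ 0 ∧ g.mulVec v = x • v := by
  have h0 : (g - x • (1 : Matrix (Fin 2) (Fin 2) ℂ)).det = 0 := by
    rw [Matrix.det_fin_two] at hdet ⊢
    simp [Matrix.trace_fin_two] at hx ⊢
    linear_combination hx + hdet
  obtain ⟨v, hv, h⟩ := Matrix.exists_mulVec_eq_zero_iff.mpr h0
  refine ⟨v, hv, ?_⟩
  rw [Matrix.sub_mulVec, Matrix.smul_mulVec, Matrix.one_mulVec, sub_eq_zero] at h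
  exact h

theorem exists_conj_diagonal {g : Matrix (Fin 2) (Fin 2) ℂ} (hdet : g.det = 1) {x y : ℂ}
    (hxy : x ≠ y) (hmul : x * y = 1) (hadd : x + y = g.trace) :
    ∃ P : Matrix (Fin 2) (Fin 2) ℂ, IsUnit P.det ∧ g * P = P * Matrix.diagonal ![x, y] := by
  obtain ⟨v, hv, hgv⟩ := exists_mulVec_eq_smul hdet (x := x)
    (by rw [← hadd]; linear_combination -hmul)
  obtain ⟨w, hw, hgw⟩ := exists_mulVec_eq_smul hdet (x := y)
    (by rw [← hadd]; linear_combination -hmul)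
  refine ⟨!![v 0, w 0; v 1, w 1], ?_, ?_⟩
  · rw [isUnit_iff_ne_zero]
    intro h0
    obtain ⟨u, hu, hPu⟩ := Matrix.exists_mulVec_eq_zero_iff.mpr h0
    -- A kernel vector of `P` is a linear relation between the eigenvectors; applying `g` and
    -- eliminating gives `u i * (x - y) = 0`.
    have h1 : u 0 • v + u 1 • w = 0 := by
      ext j
      have := congrFun hPu j
      fin_cases j <;> simp [Matrix.mulVec, dotProduct, Fin.sum_univ_two] at this ⊢ <;>
        linear_combination this
    have h2 : u 0 • x • v + u 1 • y • w = 0 := by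
      rw [← hgv, ← hgw, ← Matrix.mulVec_smul, ← Matrix.mulVec_smul, ← Matrix.mulVec_add, h1,
        Matrix.mulVec_zero]
    have h3 : (u 0 * (x - y)) • v = 0 := by
      ext j
      have a := congrFun h1 j
      have b := congrFun h2 j
      simp at a b
      change u 0 * (x - y) * v j = 0
      linear_combination b - y * a
    have h4 : (u 1 * (x - y)) • w = 0 := by
      ext j
      have a := congrFun h1 j
      have b := congrFun h2 j
      simp at a b
      change u 1 * (x - y) * w j = 0
      linear_combination x * a - b
    have hxy' := sub_ne_zero.mpr hxy
    have hu0 : u 0 = 0 := by simpa [hv, hxy'] using h3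
    have hu1 : u 1 = 0 := by simpa [hw, hxy'] using h4
    apply hu
    ext j
    fin_cases j <;> simp [hu0, hu1]
  · ext i j
    have a := congrFun hgv i
    have b := congrFun hgw i
    simp [Matrix.mulVec, dotProduct, Fin.sum_univ_two] at a b
    fin_cases i <;> fin_cases j <;> simp [Matrix.mul_apply, Fin.sum_univ_two] at a b ⊢ <;>
      first | linear_combination a | linear_combination b

theorem pow_mulVec_eq_smul {g : Matrix (Fin 2) (Fin 2) ℂ} {x : ℂ} {v : Fin 2 → ℂ}
    (h : g.mulVec v = x • v) (n : ℕ) : (g ^ n).mulVec v = x ^ n • v := by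
  induction n with
  | zero => simp
  | succ n ih => rw [pow_succ, ← Matrix.mulVec_mulVec, h, Matrix.mulVec_smul, ih, smul_smul,
      pow_succ']

theorem SU2_det (g : SU2) : g.1.det = 1 := (Matrix.mem_specialUnitaryGroup_iff.mp g.2).2

theorem SU2_inv_val (g : SU2) : (g⁻¹).1 = g.1.adjugate := by
  have h : g.1 * (g⁻¹).1 = 1 := congrArg Subtype.val (mul_inv_cancel g)
  calc (g⁻¹).1 = g.1.adjugate * (g.1 * (g⁻¹).1) := by
        rw [← mul_assoc, Matrix.adjugate_mul, SU2_det, one_smul, one_mul]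
    _ = g.1.adjugate := by rw [h, mul_one]

theorem SU2_star_val (g : SU2) : star g.1 = g.1.adjugate := by
  rw [← SU2_inv_val]; rfl

theorem SU2_trace_inv (g : SU2) : (g⁻¹).1.trace = g.1.trace := by
  rw [SU2_inv_val, Matrix.trace_fin_two, Matrix.trace_fin_two, Matrix.adjugate_fin_two]
  simp [add_comm]

theorem SU2_trace_sq (g : SU2) : (g ^ 2).1.trace = g.1.trace ^ 2 - 2 := by
  have h := SU2_det g
  have h2 : (g ^ 2).1 = g.1 * g.1 := by rw [pow_two]; rfl
  rw [Matrix.det_fin_two] at h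
  rw [h2, Matrix.trace_fin_two, Matrix.trace_fin_two]
  simp only [Matrix.mul_apply, Fin.sum_univ_two]
  linear_combination -2 * h

/-- An element of `SU(2)` of trace `2` is the identity. -/
theorem eq_one_of_trace_eq_two {g : SU2} (h : g.1.trace = 2) : g = 1 := by
  have hs := SU2_star_val g
  have hd := SU2_det g
  rw [Matrix.adjugate_fin_two] at hs
  have h11 : g.1 1 1 = star (g.1 0 0) := by
    simpa [Matrix.star_apply] using (congrFun (congrFun hs 0) 0).symm
  have h01 : g.1 0 1 = -star (g.1 1 0) := by
    have := congrFun (congrFun hs 0) 1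
    simp [Matrix.star_apply] at this
    simp [this]
  rw [Matrix.trace_fin_two, h11] at h
  rw [Matrix.det_fin_two, h11, h01] at hd
  have hre := congrArg Complex.re h
  have hdre := congrArg Complex.re hd
  simp at hre hdre
  have r : (g.1 0 0).re = 1 := by linarith
  rw [r] at hdre
  -- The determinant is `|g₀₀|² + |g₁₀|² = 1`, and `Re g₀₀ = 1` leaves no room for the other
  -- squares.
  have i0 : (g.1 0 0).im = 0 := by
    nlinarith [sq_nonneg (g.1 1 0).re, sq_nonneg (g.1 1 0).im, sq_nonneg (g.1 0 0).im]
  have a0 : (g.1 1 0).re = 0 := by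
    nlinarith [sq_nonneg (g.1 1 0).re, sq_nonneg (g.1 1 0).im, sq_nonneg (g.1 0 0).im]
  have b0 : (g.1 1 0).im = 0 := by
    nlinarith [sq_nonneg (g.1 1 0).re, sq_nonneg (g.1 1 0).im, sq_nonneg (g.1 0 0).im]
  have e00 : g.1 0 0 = 1 := Complex.ext r i0
  have e10 : g.1 1 0 = 0 := Complex.ext a0 b0
  rw [e00] at h11
  rw [e10] at h01
  apply Subtype.ext
  ext i j
  fin_cases i <;> fin_cases j <;> simp [e00, e10, h11, h01]

theorem negOne_mul_negOne : negOne * negOne = 1 := by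
  apply Subtype.ext
  change (-1 : Matrix (Fin 2) (Fin 2) ℂ) * (-1) = 1
  simp

/-- An element of `SU(2)` of trace `-2` is `-1`. -/
theorem eq_negOne_of_trace_eq_neg_two {g : SU2} (h : g.1.trace = -2) : g = negOne := by
  have h1 : negOne * g = 1 := by
    apply eq_one_of_trace_eq_two
    change ((-1 : Matrix (Fin 2) (Fin 2) ℂ) * g.1).trace = 2
    simp [h]
  calc g = negOne * (negOne * g) := by rw [← mul_assoc, negOne_mul_negOne, one_mul]
    _ = negOne := by rw [h1, mul_one]

/-! ### Values of `χ_{E_k}` at `±1` and cancellation elsewhere. -/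

theorem character_E_one (k : ℕ) : (E k).character 1 = k + 1 := by
  rw [character_E_eq, trace_substRestrict_of_conj k (P := 1) (x := 1) (y := 1)]
  · simp
  · simp
  · ext i j
    fin_cases i <;> fin_cases j <;> simp

theorem character_E_negOne (k : ℕ) : (E k).character negOne = (-1) ^ k * (k + 1) := by
  rw [character_E_eq, trace_substRestrict_of_conj k (P := 1) (x := -1) (y := -1)]
  · have : ∀ i ∈ Finset.range (k + 1), (-1 : ℂ) ^ i * (-1) ^ (k - i) = (-1) ^ k := by
      intro i hi
      rw [Finset.mem_range] at hi
      rw [← pow_add]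
      congr 1
      omega
    rw [Finset.sum_congr rfl this]
    simp [mul_comm]
  · simp
  · ext i j
    fin_cases i <;> fin_cases j <;> simp [negOne]

/-- If `g ≠ ±1` has order dividing `c` and `c ∣ a + b + 2`, the characters of `E_a` and `E_b`
cancel at `g`. -/
theorem character_E_add_eq_zero {g : SU2} (h1 : g ≠ 1) (h2 : g ≠ negOne) {c a b : ℕ}
    (hg : g ^ c = 1) (hc : c ∣ a + b + 2) : (E a).character g + (E b).character g = 0 := by
  obtain ⟨x, hx⟩ : ∃ x : ℂ, x ^ 2 - g.1.trace * x + 1 = 0 := by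
    obtain ⟨s, hs⟩ := IsAlgClosed.exists_pow_nat_eq (g.1.trace ^ 2 - 4) (n := 2) (by norm_num)
    exact ⟨(g.1.trace + s) / 2, by linear_combination hs / 4⟩
  set y := g.1.trace - x with hy
  have hmul : x * y = 1 := by rw [hy]; linear_combination -hx
  have hadd : x + y = g.1.trace := by rw [hy]; ring
  -- A double eigenvalue satisfies `x² = 1`, so the trace would be `±2`.
  have hxy : x ≠ y := by
    intro h
    rw [← h] at hmul hadd
    have : (x - 1) * (x + 1) = 0 := by linear_combination hmul
    rcases mul_eq_zero.mp this with h' | h'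
    · apply h1
      apply eq_one_of_trace_eq_two
      linear_combination -hadd + 2 * h'
    · apply h2
      apply eq_negOne_of_trace_eq_neg_two
      linear_combination -hadd + 2 * h'
  obtain ⟨P, hP, hgP⟩ := exists_conj_diagonal (SU2_det g) hxy hmul hadd
  obtain ⟨v, hv, hgv⟩ := exists_mulVec_eq_smul (SU2_det g) hx
  have hgc : g.1 ^ c = 1 := by
    have := congrArg Subtype.val hg
    simpa using this
  have hxc : x ^ c = 1 := by
    have h := pow_mulVec_eq_smul hgv c
    rw [hgc, Matrix.one_mulVec] at h
    have h' : (x ^ c - 1) • v = 0 := by rw [sub_smul, ← h, one_smul, sub_self]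
    simpa [hv, sub_eq_zero] using h'
  have hx2 : x ^ (a + 1) * x ^ (b + 1) = 1 := by
    obtain ⟨d, hd⟩ := hc
    rw [← pow_add, show a + 1 + (b + 1) = c * d by omega, pow_mul, hxc, one_pow]
  have hxya : x ^ (a + 1) * y ^ (a + 1) = 1 := by rw [← mul_pow, hmul, one_pow]
  have hxyb : x ^ (b + 1) * y ^ (b + 1) = 1 := by rw [← mul_pow, hmul, one_pow]
  have key : ∀ k : ℕ, (E k).character g * (x - y) = x ^ (k + 1) - y ^ (k + 1) := by
    intro k
    rw [character_E_eq, trace_substRestrict_of_conj k hP hgP, ← geom_sum₂_mul]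
    rfl
  have hz : ((E a).character g + (E b).character g) * (x - y) = 0 := by
    rw [add_mul, key, key]
    linear_combination (y ^ (a + 1) + y ^ (b + 1)) * hx2 - x ^ (b + 1) * hxya
      - x ^ (a + 1) * hxyb
  exact (mul_eq_zero.mp hz).resolve_right (sub_ne_zero.mpr hxy)

/-! ### Finite subgroups without `-1` are cyclic. -/

/-- In determinant one, `det (g - 1) = 2 - tr g`. -/
theorem SU2_eq_one_of_mulVec_eq {g : SU2} {v : Fin 2 → ℂ} (hv : v ≠ 0)
    (h : g.1.mulVec v = v) : g = 1 := by
  apply eq_one_of_trace_eq_two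
  have h0 : (g.1 - 1).det = 0 := by
    apply Matrix.exists_mulVec_eq_zero_iff.mp
    exact ⟨v, hv, by rw [Matrix.sub_mulVec, h, Matrix.one_mulVec, sub_self]⟩
  have hd := SU2_det g
  rw [Matrix.det_fin_two] at h0 hd
  rw [Matrix.trace_fin_two]
  simp at h0
  linear_combination hd - h0

/-- A finite subgroup of `SU(2)` with a common eigenvector is cyclic. -/
theorem isCyclic_of_common_eigenvector (Γ : Subgroup SU2) [Finite Γ] {v : Fin 2 → ℂ} (hv : v ≠ 0)
    (h : ∀ g : Γ, ∃ x : ℂ, g.1.1.mulVec v = x • v) : IsCyclic Γ := by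
  choose f hf using h
  have inj : ∀ {a b : ℂ}, a • v = b • v → a = b := fun hab => smul_left_injective ℂ hv hab
  -- The eigenvalue on `v` is a faithful character, since eigenvalue `1` forces `g = 1`.
  refine isCyclic_of_injective_ringHom (R := ℂ) ⟨⟨f, ?_⟩, ?_⟩ ?_
  · apply inj
    rw [← hf]
    simp
  · intro a b
    apply inj
    rw [← hf]
    change (a.1.1 * b.1.1).mulVec v = _
    rw [← Matrix.mulVec_mulVec, hf, Matrix.mulVec_smul, hf, smul_smul, mul_comm]
  · rw [injective_iff_map_eq_one]
    intro a ha
    apply Subtype.ext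
    apply SU2_eq_one_of_mulVec_eq hv
    have : f a = 1 := ha
    rw [hf, this, one_smul]

/-- Without a common eigenvector, every matrix commuting with the group is scalar. -/
theorem eq_smul_one_of_commute (Γ : Subgroup SU2)
    (hΓ : ¬ ∃ v : Fin 2 → ℂ, v ≠ 0 ∧ ∀ g : Γ, ∃ x : ℂ, g.1.1.mulVec v = x • v)
    {A : Matrix (Fin 2) (Fin 2) ℂ} (hA : ∀ g : Γ, g.1.1 * A = A * g.1.1) :
    A = (A.trace / 2) • (1 : Matrix (Fin 2) (Fin 2) ℂ) := by
  obtain ⟨t, ht⟩ : ∃ t : ℂ, (A - t • (1 : Matrix (Fin 2) (Fin 2) ℂ)).det = 0 := by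
    obtain ⟨s, hs⟩ := IsAlgClosed.exists_pow_nat_eq (A.trace ^ 2 - 4 * A.det) (n := 2) (by norm_num)
    refine ⟨(A.trace + s) / 2, ?_⟩
    rw [Matrix.det_fin_two, Matrix.trace_fin_two] at hs
    rw [Matrix.det_fin_two, Matrix.trace_fin_two]
    simp
    linear_combination hs / 4
  set B := A - t • (1 : Matrix (Fin 2) (Fin 2) ℂ) with hB
  have hBg : ∀ g : Γ, g.1.1 * B = B * g.1.1 := by
    intro g
    rw [hB, mul_sub, sub_mul, hA]
    simp
  obtain ⟨v, hv, hBv⟩ := Matrix.exists_mulVec_eq_zero_iff.mpr ht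
  have hB0 : B = 0 := by
    by_contra hne
    apply hΓ
    refine ⟨v, hv, fun g => ?_⟩
    set w := g.1.1.mulVec v with hw
    have hBw : B.mulVec w = 0 := by
      rw [hw, Matrix.mulVec_mulVec, ← hBg, ← Matrix.mulVec_mulVec, hBv, Matrix.mulVec_zero]
    -- The kernel of a nonzero `2 × 2` matrix is at most a line, so `w` is proportional to `v`.
    have hcross : v 0 * w 1 - v 1 * w 0 = 0 := by
      by_contra hc
      apply hne
      ext i j
      have a := congrFun hBv i
      have b := congrFun hBw i
      simp only [Matrix.mulVec, dotProduct, Fin.sum_univ_two, Pi.zero_apply] at a b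
      have h0 : B i 0 * (v 0 * w 1 - v 1 * w 0) = 0 := by linear_combination w 1 * a - v 1 * b
      have h1 : B i 1 * (v 0 * w 1 - v 1 * w 0) = 0 := by linear_combination v 0 * b - w 0 * a
      fin_cases j
      · exact (mul_eq_zero.mp h0).resolve_right hc
      · exact (mul_eq_zero.mp h1).resolve_right hc
    by_cases hv0 : v 0 = 0
    · have hv1 : v 1 ≠ 0 := fun hv1 => hv (by ext j; fin_cases j <;> simp [hv0, hv1])
      refine ⟨w 1 / v 1, ?_⟩
      ext j
      fin_cases j <;> simp <;> field_simp
      linear_combination -hcross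
    · refine ⟨w 0 / v 0, ?_⟩
      ext j
      fin_cases j <;> simp <;> field_simp
      linear_combination hcross
  have hAt : A = t • (1 : Matrix (Fin 2) (Fin 2) ℂ) := sub_eq_zero.mp hB0
  rw [hAt]
  congr 1
  simp

/-- Schur orthogonality for `ℂ²`: averaging a matrix unit over conjugation gives a scalar, fixed by
its trace. The square appears because `tr g⁻¹ = tr g` in `SU(2)`. -/
theorem sum_trace_sq (Γ : Subgroup SU2) [Fintype Γ]
    (hΓ : ¬ ∃ v : Fin 2 → ℂ, v ≠ 0 ∧ ∀ g : Γ, ∃ x : ℂ, g.1.1.mulVec v = x • v) :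
    ∑ g : Γ, g.1.1.trace ^ 2 = Fintype.card Γ := by
  have hinv : ∀ g : Γ, g.1.1 * (g⁻¹).1.1 = 1 := fun g =>
    congrArg (fun x : Γ => x.1.1) (mul_inv_cancel g)
  have hinv' : ∀ g : Γ, (g⁻¹).1.1 * g.1.1 = 1 := fun g =>
    congrArg (fun x : Γ => x.1.1) (inv_mul_cancel g)
  have key : ∀ i j : Fin 2, ∑ g : Γ, g.1.1 * Matrix.single i j 1 * (g⁻¹).1.1 =
      ((Fintype.card Γ : ℂ) * (if i = j then 1 else 0) / 2) •
        (1 : Matrix (Fin 2) (Fin 2) ℂ) := by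
    intro i j
    rw [eq_smul_one_of_commute Γ hΓ (A := ∑ g : Γ, g.1.1 * Matrix.single i j 1 * (g⁻¹).1.1)]
    · congr 2
      have : ∀ g : Γ, (g.1.1 * Matrix.single i j (1 : ℂ) * (g⁻¹).1.1).trace
          = if i = j then 1 else 0 := by
        intro g
        rw [Matrix.trace_mul_comm, ← mul_assoc, hinv', one_mul]
        split_ifs with h
        · rw [h, Matrix.trace_single_eq_same]
        · exact Matrix.trace_single_eq_of_ne _ _ _ h
      rw [Matrix.trace_sum, Finset.sum_congr rfl fun g _ => this g]
      simp
    · intro h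
      rw [Finset.mul_sum, Finset.sum_mul]
      refine Fintype.sum_equiv (Equiv.mulLeft h) _ _ fun g => ?_
      have e1 : (Equiv.mulLeft h g).1.1 = h.1.1 * g.1.1 := rfl
      have e2 : ((Equiv.mulLeft h g)⁻¹).1.1 = (g⁻¹).1.1 * (h⁻¹).1.1 := by
        rw [Equiv.coe_mulLeft, mul_inv_rev]; rfl
      rw [e1, e2]
      simp only [mul_assoc]
      rw [hinv', mul_one]
  have entry : ∀ i j : Fin 2, ∑ g : Γ, g.1.1 i i * (g⁻¹).1.1 j j =
      (Fintype.card Γ : ℂ) * (if i = j then 1 else 0) / 2 := by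
    intro i j
    have := congrFun (congrFun (key i j) i) j
    rw [Matrix.sum_apply] at this
    fin_cases i <;> fin_cases j <;>
      simpa [Matrix.mul_apply, Fin.sum_univ_two, Matrix.single_apply] using this
  have h1 : ∀ g : Γ, g.1.1.trace ^ 2 =
      g.1.1 0 0 * (g⁻¹).1.1 0 0 + g.1.1 0 0 * (g⁻¹).1.1 1 1
        + g.1.1 1 1 * (g⁻¹).1.1 0 0 + g.1.1 1 1 * (g⁻¹).1.1 1 1 := by
    intro g
    have ht : (g⁻¹).1.1.trace = g.1.1.trace := SU2_trace_inv g.1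
    rw [pow_two]
    nth_rewrite 2 [← ht]
    rw [Matrix.trace_fin_two, Matrix.trace_fin_two]
    ring
  rw [Finset.sum_congr rfl fun g _ => h1 g]
  simp only [Finset.sum_add_distrib, entry]
  simp

/-- Every vector in the image of `∑ g` is fixed by `Γ`, so a nonzero one would be a common
eigenvector. -/
theorem sum_trace_eq_zero (Γ : Subgroup SU2) [Fintype Γ]
    (hΓ : ¬ ∃ v : Fin 2 → ℂ, v ≠ 0 ∧ ∀ g : Γ, ∃ x : ℂ, g.1.1.mulVec v = x • v) :
    ∑ g : Γ, g.1.1.trace = 0 := by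
  have h0 : ∑ g : Γ, g.1.1 = 0 := by
    by_contra hne
    obtain ⟨w, hw⟩ : ∃ w : Fin 2 → ℂ, (∑ g : Γ, g.1.1).mulVec w ≠ 0 := by
      by_contra! hall
      apply hne
      ext i j
      have := congrFun (hall (Pi.single j 1)) i
      simpa using this
    refine hΓ ⟨_, hw, fun g => ⟨1, ?_⟩⟩
    rw [Matrix.mulVec_mulVec, Finset.mul_sum, one_smul]
    congr 1
    exact Fintype.sum_equiv (Equiv.mulLeft g) _ _ fun _ => rfl
  rw [← Matrix.trace_sum, h0, Matrix.trace_zero]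

/-- By Cauchy, even order yields an involution; its squared trace is `4`, so it is `±1`. -/
theorem odd_card_of_negOne_notMem (Γ : Subgroup SU2) [Finite Γ] (h : negOne ∉ Γ) :
    Odd (Nat.card Γ) := by
  rw [← Nat.not_even_iff_odd, even_iff_two_dvd]
  intro h2
  have : Fact (Nat.Prime 2) := ⟨Nat.prime_two⟩
  obtain ⟨g, hg⟩ := exists_prime_orderOf_dvd_card' 2 h2
  have hg2 : g.1 ^ 2 = 1 := by
    have := pow_orderOf_eq_one g
    rw [hg] at this
    exact congrArg Subtype.val this
  have ht := SU2_trace_sq g.1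
  rw [hg2] at ht
  have h1 : ((1 : SU2)).1.trace = 2 := by
    change (1 : Matrix (Fin 2) (Fin 2) ℂ).trace = 2
    simp
  rw [h1] at ht
  have : (g.1.1.trace - 2) * (g.1.1.trace + 2) = 0 := by linear_combination -ht
  rcases mul_eq_zero.mp this with h' | h'
  · have : g = 1 := Subtype.ext (eq_one_of_trace_eq_two (sub_eq_zero.mp h'))
    rw [this, orderOf_one] at hg
    omega
  · apply h
    rw [← eq_negOne_of_trace_eq_neg_two (eq_neg_of_add_eq_zero_left h')]
    exact g.2

/-- A finite subgroup of `SU(2)` that does not contain `-1` is cyclic. -/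
theorem isCyclic_of_negOne_notMem (Γ : Subgroup SU2) [Finite Γ] (h : negOne ∉ Γ) :
    IsCyclic Γ := by
  by_cases hΓ : ∃ v : Fin 2 → ℂ, v ≠ 0 ∧ ∀ g : Γ, ∃ x : ℂ, g.1.1.mulVec v = x • v
  · obtain ⟨v, hv, hg⟩ := hΓ
    exact isCyclic_of_common_eigenvector Γ hv hg
  · exfalso
    have := Fintype.ofFinite Γ
    have hcop : (Nat.card Γ).Coprime 2 :=
      (Nat.coprime_two_right).mpr (odd_card_of_negOne_notMem Γ h)
    have e : ∑ g : Γ, (g ^ 2).1.1.trace = ∑ g : Γ, g.1.1.trace :=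
      Fintype.sum_equiv (powCoprime hcop) _ _ fun _ => rfl
    have e2 : ∀ g : Γ, (g ^ 2).1.1.trace = g.1.1.trace ^ 2 - 2 := fun g => SU2_trace_sq g.1
    rw [Finset.sum_congr rfl fun g _ => e2 g, Finset.sum_sub_distrib, sum_trace_sq Γ hΓ,
      sum_trace_eq_zero Γ hΓ] at e
    have hc : (Fintype.card Γ : ℂ) ≠ 0 := Nat.cast_ne_zero.mpr Fintype.card_ne_zero
    simp at e
    apply hc
    linear_combination -e

/-! ### Sums of two pairings. -/

open Polynomial

/-- `(1 + f) / 2` is a projection, so the trace is the integer `2 * rank - dim`. This removes the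
conjugation from `χ_α(-1)`. -/
theorem star_trace_of_mul_self_eq_one {V : Type*} [AddCommGroup V] [Module ℂ V]
    [FiniteDimensional ℂ V] {f : Module.End ℂ V} (hf : f * f = 1) :
    star (LinearMap.trace ℂ V f) = LinearMap.trace ℂ V f := by
  have hp : IsIdempotentElem ((1 / 2 : ℂ) • (1 + f)) := by
    rw [IsIdempotentElem, smul_mul_smul_comm, mul_add, add_mul, add_mul, hf]
    simp only [one_mul, mul_one]
    module
  have h1 := (LinearMap.isProj_range_iff_isIdempotentElem _).mpr hp |>.trace
  rw [map_smul, map_add, LinearMap.trace_one] at h1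
  have h2 : LinearMap.trace ℂ V f =
      2 * (Module.finrank ℂ (LinearMap.range ((1 / 2 : ℂ) • (1 + f))) : ℂ)
        - Module.finrank ℂ V := by
    rw [← h1]
    simp
  rw [h2]
  simp

section

variable {V : Type*} [AddCommGroup V] [Module ℂ V]

theorem star_character_one [FiniteDimensional ℂ V] {G : Type*} [Group G]
    (α : Representation ℂ G V) :
    star (α.character 1) = α.character 1 := by
  rw [Representation.char_one]
  simp

theorem star_character_negOne [FiniteDimensional ℂ V] (Γ : Subgroup SU2) (h : negOne ∈ Γ)
    (α : Representation ℂ Γ V) :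
    star (α.character ⟨negOne, h⟩) = α.character ⟨negOne, h⟩ := by
  apply star_trace_of_mul_self_eq_one
  rw [← map_mul]
  have : (⟨negOne, h⟩ * ⟨negOne, h⟩ : Γ) = 1 := Subtype.ext negOne_mul_negOne
  rw [this, map_one]

theorem negOne_ne_one : negOne ≠ 1 := by
  intro h
  have := congrFun (congrFun (congrArg Subtype.val h) 0) 0
  simp [negOne] at this
  norm_num [neg_eq_iff_add_eq_zero] at this

theorem even_exponent (Γ : Subgroup SU2) (h : negOne ∈ Γ) : Even (Monoid.exponent Γ) := by
  rw [even_iff_two_dvd]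
  have : orderOf (⟨negOne, h⟩ : Γ) = 2 := by
    apply orderOf_eq_prime
    · rw [pow_two]
      exact Subtype.ext negOne_mul_negOne
    · exact fun h' => negOne_ne_one (congrArg Subtype.val h')
  exact this.symm.dvd.trans (Monoid.order_dvd_exponent _)

theorem pow_exponent_val (Γ : Subgroup SU2) (g : Γ) : g.1 ^ Monoid.exponent Γ = 1 :=
  congrArg Subtype.val (Monoid.pow_exponent_eq_one g)

theorem pairing_add_pairing_of_notMem [FiniteDimensional ℂ V] (Γ : Subgroup SU2) [Finite Γ]
    (h : negOne ∉ Γ) (α : Representation ℂ Γ V) {a b : ℕ} (hab : Monoid.exponent Γ ∣ a + b + 2) :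
    pairing Γ α a + pairing Γ α b = (Nat.card Γ : ℂ)⁻¹ * ((a + b + 2) * α.character 1) := by
  have := Fintype.ofFinite Γ
  rw [pairing, pairing, finsum_eq_sum_of_fintype, finsum_eq_sum_of_fintype, ← mul_add,
    ← Finset.sum_add_distrib, Finset.sum_eq_single 1]
  · rw [Subgroup.coe_one, character_E_one, character_E_one, star_character_one]
    ring
  · intro g _ hg
    rw [← add_mul, character_E_add_eq_zero (fun h' => hg (Subtype.ext h'))
      (fun h' => h (h' ▸ g.2)) (pow_exponent_val Γ g) hab, zero_mul]
  · simp

theorem pairing_add_pairing_of_mem [FiniteDimensional ℂ V] (Γ : Subgroup SU2) [Finite Γ]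
    (h : negOne ∈ Γ) (α : Representation ℂ Γ V) {a b : ℕ} (hab : Monoid.exponent Γ ∣ a + b + 2) :
    pairing Γ α a + pairing Γ α b =
      (Nat.card Γ : ℂ)⁻¹ * ((a + b + 2) * (α.character 1 +
        (-1) ^ a * α.character ⟨negOne, h⟩)) := by
  classical
  have := Fintype.ofFinite Γ
  have hne : (1 : Γ) ≠ ⟨negOne, h⟩ := fun h' => negOne_ne_one (congrArg Subtype.val h').symm
  -- The exponent is even, so `a` and `b` have the same parity.
  have hpar : (-1 : ℂ) ^ b = (-1) ^ a := by
    have h2 : Even (a + b + 2) := (even_exponent Γ h).trans_dvd hab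
    have h3 : Even (a + b) := by
      rcases h2 with ⟨r, hr⟩
      exact ⟨r - 1, by omega⟩
    rcases Nat.even_or_odd a with ha | ha
    · rw [ha.neg_one_pow, ((Nat.even_add.mp h3).mp ha).neg_one_pow]
    · rw [ha.neg_one_pow, Odd.neg_one_pow]
      rw [← Nat.not_even_iff_odd] at ha ⊢
      exact fun hb => ha ((Nat.even_add.mp h3).mpr hb)
  rw [pairing, pairing, finsum_eq_sum_of_fintype, finsum_eq_sum_of_fintype, ← mul_add,
    ← Finset.sum_add_distrib,
    ← Finset.sum_subset (Finset.subset_univ {(1 : Γ), ⟨negOne, h⟩}), Finset.sum_pair hne]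
  · rw [Subgroup.coe_one, character_E_one, character_E_one, star_character_one,
      star_character_negOne, character_E_negOne, character_E_negOne, hpar]
    ring
  · intro g _ hg
    simp only [Finset.mem_insert, Finset.mem_singleton, not_or] at hg
    rw [← add_mul, character_E_add_eq_zero (fun h' => hg.1 (Subtype.ext h'))
      (fun h' => hg.2 (Subtype.ext h')) (pow_exponent_val Γ g) hab, zero_mul]

/-! ### Matched indices and the case values. -/

/-- `m + m' + 2` is `c`, `2c` or `3c` for matched indices. -/
theorem IsMatchedIndex.add_eq {c m m' : ℕ} (h : IsMatchedIndex c m m') :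
    m + m' + 2 = if c = 1 then 3 else if m + 2 ≤ c then c else 2 * c := by
  obtain ⟨h1, h2, h3, d, hd⟩ := h
  -- The sum is at most `2c + 1`, which is below `3c` unless `c = 1`.
  split_ifs with hc1 hc
  · omega
  · have : d < 2 := by
      by_contra! hd2
      have := Nat.mul_le_mul_left c hd2
      omega
    interval_cases d <;> omega
  · have : d < 3 := by
      by_contra! hd2
      have := Nat.mul_le_mul_left c hd2
      omega
    interval_cases d <;> omega

theorem beta_add_gamma_of_mem [FiniteDimensional ℂ V] (Γ : Subgroup SU2) [Finite Γ]
    (h : negOne ∈ Γ) (α : Representation ℂ Γ V) {m m' : ℕ}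
    (hm : IsMatchedIndex (Monoid.exponent Γ) m m') :
    beta Γ α m + gamma Γ α m' =
      (m + m' + 2) / (Nat.card Γ : ℂ) * chiSum Γ h α m := by
  obtain ⟨h1, -, -, hd⟩ := hm
  obtain ⟨k, rfl⟩ : ∃ k, m = k + 1 := ⟨m - 1, by omega⟩
  rw [beta, gamma, Nat.add_sub_cancel, pairing_add_pairing_of_mem Γ h α
    (by convert hd using 1; ring), chiSum]
  push_cast
  ring

theorem beta_add_gamma_of_notMem [FiniteDimensional ℂ V] (Γ : Subgroup SU2) [Finite Γ]
    (h : negOne ∉ Γ) (α : Representation ℂ Γ V) {m m' : ℕ}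
    (hm : IsMatchedIndex (Monoid.exponent Γ) m m') :
    beta Γ α m + gamma Γ α m' = (m + m' + 2) / (Nat.card Γ : ℂ) * α.character 1 := by
  obtain ⟨h1, -, -, hd⟩ := hm
  obtain ⟨k, rfl⟩ : ∃ k, m = k + 1 := ⟨m - 1, by omega⟩
  rw [beta, gamma, Nat.add_sub_cancel, pairing_add_pairing_of_notMem Γ h α
    (by convert hd using 1; ring)]
  push_cast
  ring

theorem evenValue_eq (Γ : Subgroup SU2) (h : negOne ∈ Γ) (α : Representation ℂ Γ V) {m m' : ℕ}
    (hm : IsMatchedIndex (Monoid.exponent Γ) m m') :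
    evenValue Γ h α m = (m + m' + 2) / (Nat.card Γ : ℂ) * chiSum Γ h α m := by
  have hev := even_exponent Γ h
  have hadd := hm.add_eq
  have hle := hm.2.1
  have hc1 : Monoid.exponent Γ ≠ 1 := by
    intro h1
    rw [h1] at hev
    exact absurd hev (by decide)
  rw [if_neg hc1] at hadd
  have hsum : (m + m' + 2 : ℂ) = ((m + m' + 2 : ℕ) : ℂ) := by push_cast; rfl
  rw [hsum, hadd, evenValue, chiSum]
  split_ifs with ha hb
  · rfl
  · rw [hb, hev.neg_one_pow]
    push_cast
    ring
  · have : m = Monoid.exponent Γ := by omega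
    rw [this, hev.add_one.neg_one_pow]
    push_cast
    ring

theorem oddValue_eq (Γ : Subgroup SU2) [Finite Γ] (h : negOne ∉ Γ) (α : Representation ℂ Γ V)
    {m m' : ℕ}
    (hm : IsMatchedIndex (Monoid.exponent Γ) m m') :
    oddValue Γ α m = (m + m' + 2) / (Nat.card Γ : ℂ) * α.character 1 := by
  have := isCyclic_of_negOne_notMem Γ h
  have hadd := hm.add_eq
  have hcard : (Nat.card Γ : ℂ) ≠ 0 := Nat.cast_ne_zero.mpr Nat.card_pos.ne'
  have hsum : (m + m' + 2 : ℂ) = ((m + m' + 2 : ℕ) : ℂ) := by push_cast; rfl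
  -- Cyclicity turns the exponent into `#Γ`, which cancels the denominator.
  rw [hsum, hadd, oddValue, IsCyclic.exponent_eq_card]
  split_ifs with ha hb
  · rw [ha]
    norm_num
  · rw [div_self hcard, one_mul]
  · push_cast
    field_simp

/-! ### Comparison of the polynomials. -/

theorem quadratic_inj {a b c a' b' c' : ℂ} :
    (C a * X ^ 2 + C b * X + C c = C a' * X ^ 2 + C b' * X + C c' : Prop) ↔
      a = a' ∧ b = b' ∧ c = c' := by
  constructor
  · intro h
    refine ⟨?_, ?_, ?_⟩
    · simpa [coeff_X, coeff_C] using congrArg (fun p => coeff p 2) h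
    · simpa [coeff_X, coeff_C] using congrArg (fun p => coeff p 1) h
    · simpa [coeff_X, coeff_C] using congrArg (fun p => coeff p 0) h
  · rintro ⟨rfl, rfl, rfl⟩
    rfl

theorem evenPlus_eq_evenMinus_iff (Γ : Subgroup SU2) [Finite Γ] (h : negOne ∈ Γ)
    (α : Representation ℂ Γ V) {m m' : ℕ}
    (hm : IsMatchedIndex (Monoid.exponent Γ) m m') :
    evenPlus Γ h α m = evenMinus Γ h α m' ↔
      beta Γ α m + gamma Γ α m' = evenValue Γ h α m := by
  -- `m` and `m'` have equal parity because the exponent is even; this matches the `u²`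
  -- coefficients.
  have hchi : chiSum Γ h α m' = chiSum Γ h α m := by
    have h2 : Even (m + m' + 2) := (even_exponent Γ h).trans_dvd hm.2.2.2
    have h3 : Even (m + 1 + (m' + 1)) := by convert h2 using 1; ring
    have : (-1 : ℂ) ^ (m' + 1) = (-1) ^ (m + 1) := by
      rcases Nat.even_or_odd (m + 1) with ha | ha
      · rw [ha.neg_one_pow, ((Nat.even_add.mp h3).mp ha).neg_one_pow]
      · rw [ha.neg_one_pow, Odd.neg_one_pow]
        rw [← Nat.not_even_iff_odd] at ha ⊢
        exact fun hb => ha ((Nat.even_add.mp h3).mpr hb)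
    rw [chiSum, chiSum, this]
  rw [evenValue_eq Γ h α hm, evenPlus, evenMinus, hchi, quadratic_inj]
  constructor
  · rintro ⟨-, hb, -⟩
    linear_combination hb
  · intro hb
    refine ⟨rfl, ?_, ?_⟩
    · linear_combination hb
    · linear_combination hb / 2

theorem oddPlus_eq_oddMinus_iff [FiniteDimensional ℂ V] (Γ : Subgroup SU2) [Finite Γ]
    (h : negOne ∉ Γ) (α : Representation ℂ Γ V) {m m' : ℕ}
    (hm : IsMatchedIndex (Monoid.exponent Γ) m m') :
    oddPlus Γ α m = oddMinus Γ α m' ↔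
      beta Γ α m + gamma Γ α m' = oddValue Γ α m := by
  rw [oddValue_eq Γ h α hm, oddPlus, oddMinus, quadratic_inj, Representation.char_one]
  constructor
  · rintro ⟨-, hb, -⟩
    linear_combination hb
  · intro hb
    refine ⟨rfl, ?_, ?_⟩
    · linear_combination hb
    · linear_combination hb / 2

end

end TwistedSpectrum

end

theorem mainTheorem7 {V : Type*} [AddCommGroup V] [Module ℂ V] [FiniteDimensional ℂ V]
    (Γ : Subgroup TwistedSpectrum.SU2) [Finite Γ]
    (α : Representation ℂ Γ V) [α.IsIrreducible] :
    (∀ h : TwistedSpectrum.negOne ∈ Γ,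
      ∀ m m' : ℕ, TwistedSpectrum.IsMatchedIndex (Monoid.exponent Γ) m m' →
        (TwistedSpectrum.evenPlus Γ h α m = TwistedSpectrum.evenMinus Γ h α m' ↔
          TwistedSpectrum.beta Γ α m + TwistedSpectrum.gamma Γ α m' =
            TwistedSpectrum.evenValue Γ h α m) ∧
        TwistedSpectrum.beta Γ α m + TwistedSpectrum.gamma Γ α m' =
          TwistedSpectrum.evenValue Γ h α m) ∧
    (TwistedSpectrum.negOne ∉ Γ →
      ∀ m m' : ℕ, TwistedSpectrum.IsMatchedIndex (Monoid.exponent Γ) m m' →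
        (TwistedSpectrum.oddPlus Γ α m = TwistedSpectrum.oddMinus Γ α m' ↔
          TwistedSpectrum.beta Γ α m + TwistedSpectrum.gamma Γ α m' =
            TwistedSpectrum.oddValue Γ α m) ∧
        TwistedSpectrum.beta Γ α m + TwistedSpectrum.gamma Γ α m' =
          TwistedSpectrum.oddValue Γ α m) := by
  constructor
  · intro h m m' hm
    refine ⟨TwistedSpectrum.evenPlus_eq_evenMinus_iff Γ h α hm, ?_⟩
    rw [TwistedSpectrum.beta_add_gamma_of_mem Γ h α hm, TwistedSpectrum.evenValue_eq Γ h α hm]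
  · intro h m m' hm
    refine ⟨TwistedSpectrum.oddPlus_eq_oddMinus_iff Γ h α hm, ?_⟩
    rw [TwistedSpectrum.beta_add_gamma_of_notMem Γ h α hm, TwistedSpectrum.oddValue_eq Γ h α hm]
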